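/- Let $\mathbf F_q$ be a finite field of odd characteristic, $R=\mathbf F_q[T]$ and $k=\mathbf F_q(T)$. Let $m\ge 1$ be an integer, let $a\in R$ be non-constant, and suppose that $A=2a+1$ is monic and that $A=SP$ with $S,P\in R$, $P$ irreducible and $\deg S\ge 2$. Let $D\in R$ be square-free and of one of the four forms $$\text{(1)}\ D=(A^m+a)^2+A,\qquad \text{(2)}\ D=(A^m-a)^2+A,$$ $$\text{(3)}\ D=(A^m+a+1)^2-A,\qquad \text{(4)}\ D=(A^m-a-1)^2-A,$$ where in forms (1) and (3) the case in which $m=1$ and $\mathbf F_q$ has characteristic $3$ is excluded. Let $K=k(\sqrt D)$, and let $h(D)$ be its ideal class number, that is, the order of the ideal class group of the integral closure of $R$ in $K$. Then $$h(D)\ \ge\ \frac{\deg(SP)}{\deg P}\ >\ 1 ;$$ in particular, $K$ has ideal class number greater than one. -/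

import Mathlib

open scoped Polynomial

/-- The ideal class number of an extension `K` of `Fq(T)`: the order of the ideal class group of
the ring of integers of `K`, i.e. of the integral closure of `Fq[T]` in `K`.
(`Nat.card` is `0` for an infinite group, so a positive lower bound includes finiteness.) -/
noncomputable def idealClassNumber (Fq K : Type*) [Field Fq] [Field K] [Algebra Fq[X] K] : ℕ :=
  Nat.card (ClassGroup (FunctionField.ringOfIntegers Fq K))

/-! In every form `D = r ^ 2 - σ * A` with signs `σ`, `τ` satisfying `2 * r = 2 * A ^ m - τ - τ * σ
* A`. Put `α = r + √D` and `γ = r - √D`, so that `α * γ = σ * A`, and `β = α + τ`, whose norm is `2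
* τ * A ^ m`. Then `γ ^ m` divides `β` and the quotient is an explicit unit `ε`.

The key fact (`exists_unit_mul_eq_algebraMap`) is that an element `z` of `F[X][√D]` with nonzero
norm of degree below `deg A` is a polynomial up to a unit. Since `D` is a square at infinity, `z`
has two degrees there, one for each sign of the root. Multiplying by a suitable `ε ^ k * γ ^ j`
brings both below `deg √D = m * deg A`, which forces the product to be a polynomial `x`. Conjugation
and coprimality of `α`, `γ` give `A ^ j ∣ x`, and comparing norms leaves only `j = 0`.

For `P ∣ A`, `D` is a nonzero square `b ^ 2` modulo `P`, so `P` splits. If the `t`-th power of a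
prime above `P` is generated by `z`, the norm of `z` is `P ^ t` up to a unit. Were `t * deg P < deg
A`, `z` would be a polynomial up to a unit, hence divisible by `P` and so by both primes above `P`,
which is absurd. Taking for `t` the order of the ideal class gives the bound, because that order is
at most the class number. -/

/-! ### Laurent series at infinity and their square roots. -/

section Laurent

variable {F : Type*} [Field F]

/-- The embedding of `F[X]` into Laurent series at infinity, sending `X` to the inverse of the
uniformizer. -/
noncomputable def polyAtInfty (F : Type*) [Field F] : F[X] →+* LaurentSeries F :=
  Polynomial.eval₂RingHom HahnSeries.C (HahnSeries.single (-1) 1)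

theorem polyAtInfty_monomial (n : ℕ) (c : F) :
    polyAtInfty F (Polynomial.monomial n c) = HahnSeries.single (-(n : ℤ)) c := by
  have h : (HahnSeries.single (-1 : ℤ) (1 : F)) ^ n = HahnSeries.single (-(n : ℤ)) 1 := by
    rw [HahnSeries.single_pow]; simp
  rw [polyAtInfty, Polynomial.coe_eval₂RingHom, Polynomial.eval₂_monomial, h,
    HahnSeries.C_apply, HahnSeries.single_mul_single]
  simp

theorem coeff_polyAtInfty_neg (p : F[X]) (n : ℕ) :
    (polyAtInfty F p).coeff (-(n : ℤ)) = p.coeff n := by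
  induction p using Polynomial.induction_on' with
  | add p q hp hq => simp [hp, hq]
  | monomial k c =>
    rw [polyAtInfty_monomial, HahnSeries.coeff_single, Polynomial.coeff_monomial]
    simp [eq_comm]

theorem polyAtInfty_ne_zero {p : F[X]} (hp : p ≠ 0) : polyAtInfty F p ≠ 0 := by
  intro h
  apply hp
  ext n
  rw [← coeff_polyAtInfty_neg, h]
  simp

theorem order_polyAtInfty {p : F[X]} (hp : p ≠ 0) :
    (polyAtInfty F p).order = -(p.natDegree : ℤ) := by
  apply le_antisymm
  · apply HahnSeries.order_le_of_coeff_ne_zero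
    rw [coeff_polyAtInfty_neg]
    exact Polynomial.leadingCoeff_ne_zero.mpr hp
  · rw [HahnSeries.le_order_iff_forall (polyAtInfty_ne_zero hp)]
    intro j hj
    obtain ⟨n, rfl⟩ : ∃ n : ℕ, j = -(n : ℤ) := ⟨j.natAbs, by omega⟩
    rw [coeff_polyAtInfty_neg]
    exact Polynomial.coeff_eq_zero_of_natDegree_lt (by omega)

/-- Hensel's lemma for `Y ^ 2 - (1 + X * f)` at the approximate root `1`, where the derivative is
the unit `2`. -/
theorem PowerSeries.exists_sq_eq_one_add_X_mul (h2 : (2 : F) ≠ 0) (f : PowerSeries F) :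
    ∃ g : PowerSeries F, g ^ 2 = 1 + PowerSeries.X * f ∧ PowerSeries.constantCoeff g = 1 := by
  let I : Ideal (PowerSeries F) := Ideal.span {PowerSeries.X}
  have : HenselianRing (PowerSeries F) I := inferInstance
  have hu : IsUnit (2 : PowerSeries F) := by
    rw [PowerSeries.isUnit_iff_constantCoeff, map_ofNat]
    exact h2.isUnit
  obtain ⟨g, hg, hg'⟩ := HenselianRing.is_henselian (I := I)
    (Polynomial.X ^ 2 - Polynomial.C (1 + PowerSeries.X * f))
    (Polynomial.monic_X_pow_sub_C _ two_ne_zero) 1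
    (by
      rw [Ideal.mem_span_singleton]
      exact ⟨-f, by simp⟩)
    (by
      apply IsUnit.map
      simpa [one_add_one_eq_two] using hu)
  refine ⟨g, ?_, ?_⟩
  · simpa [Polynomial.IsRoot, sub_eq_zero] using hg
  · rw [Ideal.mem_span_singleton, PowerSeries.X_dvd_iff] at hg'
    simpa [sub_eq_zero] using hg'

theorem LaurentSeries.exists_sq_eq_one_add (h2 : (2 : F) ≠ 0) (h : LaurentSeries F)
    (hh : 0 < h.order) :
    ∃ g : LaurentSeries F, g ^ 2 = 1 + h ∧ (1 + g).order = 0 ∧ 1 + g ≠ 0 ∧ g.order = 0 ∧ g ≠ 0 := by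
  obtain ⟨n, hn⟩ : ∃ n : ℕ, h.order = n + 1 := ⟨(h.order - 1).toNat, by omega⟩
  have hf : h = ((PowerSeries.X * (PowerSeries.X ^ n * h.powerSeriesPart) : PowerSeries F) :
      LaurentSeries F) := by
    have := LaurentSeries.X_order_mul_powerSeriesPart (f := h) (n := n + 1) (by simp [hn])
    rw [← mul_assoc, ← pow_succ']
    simpa using this.symm
  obtain ⟨g, hg, hg1⟩ := PowerSeries.exists_sq_eq_one_add_X_mul h2
    (PowerSeries.X ^ n * h.powerSeriesPart)
  have key : ∀ f : PowerSeries F, PowerSeries.constantCoeff f ≠ 0 →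
      (f : LaurentSeries F).order = 0 ∧ (f : LaurentSeries F) ≠ 0 := by
    intro f hf0
    have hc : (f : LaurentSeries F).coeff 0 ≠ 0 := by
      simpa [LaurentSeries.coeff_coe_powerSeries] using
        (show (f : LaurentSeries F).coeff ((0 : ℕ) : ℤ) ≠ 0 by
          rw [LaurentSeries.coeff_coe_powerSeries]; simpa using hf0)
    have hne : (f : LaurentSeries F) ≠ 0 := by
      intro h0; rw [h0] at hc; simp at hc
    refine ⟨le_antisymm (HahnSeries.order_le_of_coeff_ne_zero hc) ?_, hne⟩
    rw [HahnSeries.le_order_iff_forall hne]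
    intro j hj
    rw [PowerSeries.coeff_coe, if_pos hj]
  refine ⟨(g : LaurentSeries F), ?_, ?_⟩
  · rw [← PowerSeries.coe_pow, hg, PowerSeries.coe_add, ← hf]; simp
  · have := key (1 + g) (by
      rw [map_add, hg1, map_one, one_add_one_eq_two]; exact h2)
    have h3 := key g (by rw [hg1]; exact one_ne_zero)
    rw [PowerSeries.coe_add, PowerSeries.coe_one] at this
    exact ⟨this.1, this.2, h3⟩

end Laurent

/-! ### Degrees at the two infinite places and their balancing. -/

section Core

variable {F : Type*} [Field F]

/-- Factoring out `r` leaves the root of a series `1 + h` with `h` of positive order. The root `s`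
chosen has the same leading term as `r`, so `r + s` has leading coefficient doubled and does not
cancel in odd characteristic. -/
theorem exists_sqrt_at_infty (h2 : (2 : F) ≠ 0) {r B : F[X]} (hB : B ≠ 0)
    (hdeg : B.natDegree < 2 * r.natDegree) :
    ∃ s : LaurentSeries F, s ^ 2 = polyAtInfty F (r ^ 2 - B) ∧
      polyAtInfty F r + s ≠ 0 ∧ (polyAtInfty F r + s).order = -(r.natDegree : ℤ) ∧
      s ≠ 0 ∧ s.order = -(r.natDegree : ℤ) := by
  have hr : r ≠ 0 := by rintro rfl; simp at hdeg
  have hr' := polyAtInfty_ne_zero hr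
  have hq : polyAtInfty F (-B) / polyAtInfty F r ^ 2 ≠ 0 :=
    div_ne_zero (polyAtInfty_ne_zero (neg_ne_zero.mpr hB)) (pow_ne_zero _ hr')
  have hmul : polyAtInfty F (-B) / polyAtInfty F r ^ 2 * polyAtInfty F r ^ 2 =
    polyAtInfty F (-B) := div_mul_cancel₀ _ (pow_ne_zero _ hr')
  have ho := HahnSeries.order_mul hq (pow_ne_zero 2 hr')
  rw [hmul, order_polyAtInfty (neg_ne_zero.mpr hB), HahnSeries.order_pow, order_polyAtInfty hr,
    Polynomial.natDegree_neg] at ho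
  obtain ⟨g, hg, h1, h1', h0, h0'⟩ := LaurentSeries.exists_sq_eq_one_add h2
    (polyAtInfty F (-B) / polyAtInfty F r ^ 2) (by
      rw [nsmul_eq_mul] at ho; push_cast at ho; omega)
  refine ⟨polyAtInfty F r * g, ?_, ?_, ?_, mul_ne_zero hr' h0', ?_⟩
  · rw [mul_pow, hg, mul_add, mul_one, mul_comm _ (_ / _), hmul, map_sub, map_neg, map_pow,
      sub_eq_add_neg]
  · rw [← mul_one_add]; exact mul_ne_zero hr' h1'
  · rw [← mul_one_add, HahnSeries.order_mul hr' h1', h1, order_polyAtInfty hr, add_zero]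
  · rw [HahnSeries.order_mul hr' h0', h0, order_polyAtInfty hr, add_zero]

/-- The embedding of `F[X][√D]` into Laurent series determined by a square root of `D`. -/
noncomputable def quadAtInfty {D : F[X]} (s : LaurentSeries F) (hs : s ^ 2 = polyAtInfty F D) :
    QuadraticAlgebra F[X] D 0 →+* LaurentSeries F where
  toFun z := polyAtInfty F z.re + polyAtInfty F z.im * s
  map_one' := by simp [QuadraticAlgebra.re_one, QuadraticAlgebra.im_one]
  map_zero' := by simp
  map_add' x y := by simp; ring
  map_mul' x y := by
    simp only [QuadraticAlgebra.re_mul, QuadraticAlgebra.im_mul, map_add, map_mul, ← hs, map_zero]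
    ring

theorem quadAtInfty_apply {D : F[X]} (s : LaurentSeries F) (hs : s ^ 2 = polyAtInfty F D)
    (z : QuadraticAlgebra F[X] D 0) :
    quadAtInfty s hs z = polyAtInfty F z.re + polyAtInfty F z.im * s := rfl

theorem quadAtInfty_mul_conj {D : F[X]} (s : LaurentSeries F) (hs : s ^ 2 = polyAtInfty F D)
    (hs' : (-s) ^ 2 = polyAtInfty F D) (z : QuadraticAlgebra F[X] D 0) :
    quadAtInfty s hs z * quadAtInfty (-s) hs' z = polyAtInfty F z.norm := by
  simp only [quadAtInfty_apply, QuadraticAlgebra.norm_def, map_sub, map_add, map_mul, map_zero,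
    ← hs]
  ring

/-- The intervals swept out by the powers of an element of norm degree `d` cover a full period
of the unit. -/
theorem exists_balancing_exponents {m : ℕ} (hm : 1 ≤ m) {d n : ℤ} (hn : 0 ≤ n) (hnd : n < d)
    (δ : ℤ) : ∃ k : ℤ, ∃ j : ℕ, j ≤ m ∧
      |δ + k * (2 * (m * (m * d))) - j * ((2 * m - 1) * d)| < (2 * m - j) * d - n := by
  have hmz : (1 : ℤ) ≤ m := by exact_mod_cast hm
  have hT : 0 < 2 * ((m : ℤ) * (m * d)) := by
    have : 0 < d := by omega
    positivity
  set T := 2 * ((m : ℤ) * (m * d)) with hTdef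
  -- The shift by `n` places the reduced value in `[-n, T - n)`, whose upper end is exactly that of
  -- the last interval, `j = m`.
  refine ⟨-((δ + n) / T), ?_⟩
  have h1 : δ + -((δ + n) / T) * T = (δ + n) % T - n := by
    have := Int.emod_add_mul_ediv (δ + n) T
    linarith
  have h3 := Int.emod_nonneg (δ + n) hT.ne'
  have h4 := Int.emod_lt_of_pos (δ + n) hT
  rw [h1]
  generalize (δ + n) % T = x at h3 h4
  -- The `j`-th interval runs from `2 * m * (j - 1) * d + n` to `2 * (m * (j + 1) - j) * d - n`. For
  -- `j < m` it overlaps the next one because `n < d ≤ (m - j) * d`, so no gaps occur.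
  have key : ∀ J : ℕ, J ≤ m → x - n < 2 * (m * (J + 1) - J) * d - n →
      ∃ j : ℕ, j ≤ J ∧ |x - n - j * ((2 * m - 1) * d)| < (2 * m - j) * d - n := by
    intro J
    induction J with
    | zero =>
      intro _ h
      refine ⟨0, le_rfl, ?_⟩
      rw [abs_lt]
      push_cast at h ⊢
      constructor <;> nlinarith
    | succ J ih =>
      intro hJ h
      by_cases hx : x - n < 2 * (m * (J + 1) - J) * d - n
      · obtain ⟨j, hj, hj'⟩ := ih (by omega) hx
        exact ⟨j, by omega, hj'⟩
      · refine ⟨J + 1, le_rfl, ?_⟩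
        have hJm : (J : ℤ) + 1 ≤ m := by exact_mod_cast hJ
        have h5 : d ≤ (m - J) * d := by nlinarith
        rw [abs_lt]
        push_cast at h hx ⊢
        constructor <;> nlinarith
  obtain ⟨j, hj, hj'⟩ := key m le_rfl (by
    have : 2 * ((m : ℤ) * (m + 1) - m) * d = T := by rw [hTdef]; ring
    rw [this]; linarith)
  exact ⟨j, hj, hj'⟩

variable {D : F[X]}

theorem QuadraticAlgebra.norm_unit_ne_zero (u : (QuadraticAlgebra F[X] D 0)ˣ) :
    QuadraticAlgebra.norm (u : QuadraticAlgebra F[X] D 0) ≠ 0 :=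
  (QuadraticAlgebra.isUnit_iff_norm_isUnit.mp u.isUnit).ne_zero

theorem map_units_zpow_of_norm {v : QuadraticAlgebra F[X] D 0 → ℤ}
    (hv : ∀ x y, x.norm ≠ 0 → y.norm ≠ 0 → v (x * y) = v x + v y)
    (u : (QuadraticAlgebra F[X] D 0)ˣ) (k : ℤ) :
    v ((u ^ k : (QuadraticAlgebra F[X] D 0)ˣ) : QuadraticAlgebra F[X] D 0) = k * v u := by
  let f : (QuadraticAlgebra F[X] D 0)ˣ →* Multiplicative ℤ :=
    MonoidHom.mk' (fun u => Multiplicative.ofAdd (v u)) fun a b => by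
      rw [Units.val_mul, hv _ _ (QuadraticAlgebra.norm_unit_ne_zero a)
        (QuadraticAlgebra.norm_unit_ne_zero b), ofAdd_add]
  have h := congrArg Multiplicative.toAdd (map_zpow f u k)
  simpa [f] using h

theorem map_pow_of_norm {v : QuadraticAlgebra F[X] D 0 → ℤ}
    (hv : ∀ x y, x.norm ≠ 0 → y.norm ≠ 0 → v (x * y) = v x + v y)
    {x : QuadraticAlgebra F[X] D 0} (hx : x.norm ≠ 0) (j : ℕ) : v (x ^ j) = j * v x := by
  induction j with
  | zero =>
    have := hv 1 1 (by simp) (by simp)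
    simp at this
    simp [this]
  | succ j ih =>
    rw [pow_succ, hv _ _ (by rw [map_pow]; exact pow_ne_zero _ hx) hx, ih]
    push_cast; ring

/-- Here `v`, `w` stand for the degrees at the two infinite places. The sum of the two degrees of `y
= z * ε ^ k * γ ^ j` is `z.norm.natDegree + j * d`, and the balancing inequality bounds their
difference so that both fall below `m * d`; by `him` the `√D`-component of `y` then vanishes. -/
theorem exists_mul_eq_algebraMap_of_degrees {m d : ℕ} (hm : 1 ≤ m)
    {v w : QuadraticAlgebra F[X] D 0 → ℤ}
    (hv : ∀ x y, x.norm ≠ 0 → y.norm ≠ 0 → v (x * y) = v x + v y)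
    (hw : ∀ x y, x.norm ≠ 0 → y.norm ≠ 0 → w (x * y) = w x + w y)
    (hvw : ∀ x, x.norm ≠ 0 → v x + w x = x.norm.natDegree)
    (him : ∀ x, x.norm ≠ 0 → x.im ≠ 0 → (m * d : ℤ) ≤ max (v x) (w x))
    {γ : QuadraticAlgebra F[X] D 0} (hγ : γ.norm ≠ 0)
    (hvγ : v γ = d - m * d) (hwγ : w γ = m * d)
    (ε : (QuadraticAlgebra F[X] D 0)ˣ) (hvε : v ε = m * (m * d)) (hwε : w ε = -(m * (m * d)))
    {z : QuadraticAlgebra F[X] D 0} (hz : z.norm ≠ 0) (hzd : z.norm.natDegree < d) :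
    ∃ k : ℤ, ∃ j : ℕ, ∃ x : F[X], z * (ε ^ k : (QuadraticAlgebra F[X] D 0)ˣ) * γ ^ j =
      algebraMap F[X] _ x := by
  obtain ⟨k, j, hj, hkj⟩ := exists_balancing_exponents hm
    (Int.natCast_nonneg z.norm.natDegree) (Int.ofNat_lt.mpr hzd) (v z - w z)
  refine ⟨k, j, ?_⟩
  have hε := QuadraticAlgebra.norm_unit_ne_zero (ε ^ k)
  have hzε : (z * (ε ^ k : (QuadraticAlgebra F[X] D 0)ˣ)).norm ≠ 0 := by
    rw [map_mul]; exact mul_ne_zero hz hε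
  have hγj : (γ ^ j).norm ≠ 0 := by rw [map_pow]; exact pow_ne_zero _ hγ
  set y := z * (ε ^ k : (QuadraticAlgebra F[X] D 0)ˣ) * γ ^ j with hy
  have hvy : v y = v z + k * (m * (m * d)) + j * (d - m * d) := by
    rw [hy, hv _ _ hzε hγj, hv _ _ hz hε, map_units_zpow_of_norm hv, map_pow_of_norm hv hγ, hvγ,
      hvε]
  have hwy : w y = w z - k * (m * (m * d)) + j * (m * d) := by
    rw [hy, hw _ _ hzε hγj, hw _ _ hz hε, map_units_zpow_of_norm hw, map_pow_of_norm hw hγ, hwγ,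
      hwε]
    ring
  have hy0 : y.norm ≠ 0 := by rw [hy, map_mul]; exact mul_ne_zero hzε hγj
  have hyim : y.im = 0 := by
    by_contra h
    have h1 := him y hy0 h
    have h2 := hvw z hz
    rw [abs_lt] at hkj
    rcases le_max_iff.mp h1 with h | h
    · rw [hvy] at h; linarith [hkj.1, hkj.2]
    · rw [hwy] at h; linarith [hkj.1, hkj.2]
  refine ⟨y.re, ?_⟩
  ext <;> simp [hyim, QuadraticAlgebra.algebraMap_eq]

end Core

/-! ### Elements of small norm and powers of a split prime. -/

section SmallNorm

variable {F : Type*} [Field F] {D : F[X]}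

theorem QuadraticAlgebra.algebraMap_dvd_algebraMap {R : Type*} [CommRing R] {a b : R} {x y : R}
    (h : algebraMap R (QuadraticAlgebra R a b) x ∣ algebraMap R (QuadraticAlgebra R a b) y) :
    x ∣ y := by
  obtain ⟨z, hz⟩ := h
  refine ⟨z.re, ?_⟩
  have := congrArg QuadraticAlgebra.re hz
  simpa [QuadraticAlgebra.algebraMap_eq] using this

/-- In the real quadratic orders of Richaud-Degert type considered here, the elements of small
norm are, up to units, polynomials. -/
theorem exists_unit_mul_eq_algebraMap (h2 : (2 : F) ≠ 0) {r A σ τ : F[X]} {m : ℕ} (hm : 1 ≤ m)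
    (hσ : σ ^ 2 = 1) (hτ : τ ^ 2 = 1) (hA : 0 < A.natDegree) (hD : D = r ^ 2 - σ * A)
    (h2r : 2 * r = 2 * A ^ m - τ - τ * σ * A) (hr : r.natDegree = m * A.natDegree)
    {z : QuadraticAlgebra F[X] D 0} (hz : z.norm ≠ 0) (hzd : z.norm.natDegree < A.natDegree) :
    ∃ u : (QuadraticAlgebra F[X] D 0)ˣ, ∃ x : F[X], z * u = algebraMap F[X] _ x := by
  have hσu : IsUnit σ := IsUnit.of_pow_eq_one hσ two_ne_zero
  have hτu : IsUnit τ := IsUnit.of_pow_eq_one hτ two_ne_zero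
  have h2u : IsUnit (2 : F[X]) := by
    rw [← map_ofNat Polynomial.C 2]
    exact Polynomial.isUnit_C.mpr h2.isUnit
  have hA0 : A ≠ 0 := by rintro rfl; simp at hA
  have hσA : (σ * A).natDegree = A.natDegree := by
    rw [Polynomial.natDegree_mul hσu.ne_zero hA0, Polynomial.natDegree_eq_zero_of_isUnit hσu,
      zero_add]
  set d := A.natDegree with hd
  have hmd : d ≤ m * d := Nat.le_mul_of_pos_left d hm
  obtain ⟨s, hs, hrs0, hrs, hs0, hso⟩ := exists_sqrt_at_infty h2 (r := r) (B := σ * A)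
    (mul_ne_zero hσu.ne_zero hA0) (by omega)
  rw [← hD] at hs
  have hs' : (-s) ^ 2 = polyAtInfty F D := by rw [neg_sq, hs]
  have hne : ∀ x : QuadraticAlgebra F[X] D 0, x.norm ≠ 0 →
      quadAtInfty s hs x ≠ 0 ∧ quadAtInfty (-s) hs' x ≠ 0 := by
    intro x hx
    have := polyAtInfty_ne_zero hx
    rw [← quadAtInfty_mul_conj s hs hs'] at this
    exact mul_ne_zero_iff.mp this
  set v : QuadraticAlgebra F[X] D 0 → ℤ := fun x => -(quadAtInfty s hs x).order with hvdef
  set w : QuadraticAlgebra F[X] D 0 → ℤ := fun x => -(quadAtInfty (-s) hs' x).order with hwdef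
  have hv : ∀ x y : QuadraticAlgebra F[X] D 0, x.norm ≠ 0 → y.norm ≠ 0 →
      v (x * y) = v x + v y := by
    intro x y hx hy
    simp only [hvdef, map_mul, HahnSeries.order_mul (hne x hx).1 (hne y hy).1, neg_add]
  have hw : ∀ x y : QuadraticAlgebra F[X] D 0, x.norm ≠ 0 → y.norm ≠ 0 →
      w (x * y) = w x + w y := by
    intro x y hx hy
    simp only [hwdef, map_mul, HahnSeries.order_mul (hne x hx).2 (hne y hy).2, neg_add]
  have hvw : ∀ x : QuadraticAlgebra F[X] D 0, x.norm ≠ 0 → v x + w x = x.norm.natDegree := by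
    intro x hx
    have h := HahnSeries.order_mul (hne x hx).1 (hne x hx).2
    rw [quadAtInfty_mul_conj, order_polyAtInfty hx] at h
    simp only [hvdef, hwdef]
    linarith
  -- The difference of the two images of `x` is `2 * x.im * s`, of degree at least `m * d`, so one
  -- of the images has degree at least that large.
  have him : ∀ x : QuadraticAlgebra F[X] D 0, x.norm ≠ 0 → x.im ≠ 0 →
      (m * d : ℤ) ≤ max (v x) (w x) := by
    intro x hx hxi
    have h2i : (2 * x.im) ≠ 0 := mul_ne_zero h2u.ne_zero hxi
    have h := HahnSeries.order_mul (polyAtInfty_ne_zero h2i) hs0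
    have he : polyAtInfty F (2 * x.im) * s =
        quadAtInfty s hs x + -quadAtInfty (-s) hs' x := by
      rw [quadAtInfty_apply, quadAtInfty_apply, map_mul, map_ofNat]; ring
    have h3 := HahnSeries.min_order_le_order_add
      (x := quadAtInfty s hs x) (y := -quadAtInfty (-s) hs' x)
      (by rw [← he]; exact mul_ne_zero (polyAtInfty_ne_zero h2i) hs0)
    rw [← he, h, order_polyAtInfty h2i, hso, HahnSeries.order_neg, hr] at h3
    push_cast at h3
    simp only [hvdef, hwdef]
    rw [le_max_iff]
    rcases min_le_iff.mp h3 with h | h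
    · left; linarith [Int.natCast_nonneg (2 * x.im).natDegree]
    · right; linarith [Int.natCast_nonneg (2 * x.im).natDegree]
  let α : QuadraticAlgebra F[X] D 0 := ⟨r, 1⟩
  let γ : QuadraticAlgebra F[X] D 0 := ⟨r, -1⟩
  let β : QuadraticAlgebra F[X] D 0 := ⟨r + τ, 1⟩
  let ι : F[X] →+* QuadraticAlgebra F[X] D 0 := algebraMap _ _
  have hστ : ι σ ^ 2 = 1 ∧ ι τ ^ 2 = 1 := by
    rw [← map_pow, ← map_pow, hσ, hτ, map_one]; exact ⟨rfl, rfl⟩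
  have hαγ : α * γ = ι (σ * A) := by
    apply QuadraticAlgebra.ext
    · simp [α, γ, ι, QuadraticAlgebra.algebraMap_eq, hD]; ring
    · simp [α, γ, ι, QuadraticAlgebra.algebraMap_eq]
  have hAαγ : ι A = ι σ * (α * γ) := by
    rw [hαγ, map_mul, ← mul_assoc, ← sq, hστ.1, one_mul]
  have hsum : α + γ = 2 * ι A ^ m - ι τ - ι τ * ι σ * ι A := by
    have : α + γ = ι (2 * r) := by
      apply QuadraticAlgebra.ext
      · simp [α, γ, ι, QuadraticAlgebra.algebraMap_eq]; ring
      · simp [α, γ, ι, QuadraticAlgebra.algebraMap_eq]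
    rw [this, h2r]; simp only [map_sub, map_mul, map_pow, map_ofNat]
  have hβα : β = α + ι τ := by
    apply QuadraticAlgebra.ext <;> simp [α, β, ι, QuadraticAlgebra.algebraMap_eq]
  have hββ : β * (γ + ι τ) = ι (2 * τ * A ^ m) := by
    rw [hβα]
    have : (α + ι τ) * (γ + ι τ) = α * γ + ι τ * (α + γ) + ι τ ^ 2 := by ring
    rw [this, hsum, hαγ]
    simp only [map_mul, map_pow, map_ofNat]
    linear_combination -(ι σ * ι A) * hστ.2
  have hγn : γ.norm = σ * A := by
    rw [QuadraticAlgebra.norm_def]; simp [γ, hD]; ring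
  have hβn : β.norm = 2 * τ * A ^ m := by
    rw [QuadraticAlgebra.norm_def]
    simp only [β, hD]
    linear_combination τ * h2r - (σ * A) * hτ
  have hγ0 : γ.norm ≠ 0 := by rw [hγn]; exact mul_ne_zero hσu.ne_zero hA0
  have hβ0 : β.norm ≠ 0 := by
    rw [hβn]; exact mul_ne_zero (mul_ne_zero h2u.ne_zero hτu.ne_zero) (pow_ne_zero _ hA0)
  -- Since `τ ^ 2 = 1`, `γ` and the conjugate `γ + τ` of `β` are coprime, so the factor `γ ^ m` of
  -- `β * (γ + τ) = 2 * τ * A ^ m` must divide `β`.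
  have hcop : IsCoprime (γ ^ m) (γ + ι τ) :=
    IsCoprime.pow_left ⟨-ι τ, ι τ, by linear_combination hστ.2⟩
  obtain ⟨e, he⟩ : γ ^ m ∣ β := by
    apply hcop.dvd_of_dvd_mul_right
    rw [hββ, map_mul, map_pow, hAαγ]
    exact ⟨ι (2 * τ) * ι σ ^ m * α ^ m, by ring⟩
  have heu : IsUnit e := by
    rw [QuadraticAlgebra.isUnit_iff_norm_isUnit]
    have h := hβn
    rw [he, map_mul, map_pow, hγn, mul_pow] at h
    have h' : σ ^ m * e.norm = 2 * τ := by
      apply mul_right_cancel₀ (pow_ne_zero m hA0)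
      rw [← h]; ring
    exact isUnit_of_mul_isUnit_right (h' ▸ h2u.mul hτu)
  obtain ⟨ε, rfl⟩ := heu
  have hwγ : w γ = m * d := by
    have : quadAtInfty (-s) hs' γ = polyAtInfty F r + s := by
      simp [quadAtInfty_apply, γ]
    simp only [hwdef, this, hrs, hr]
    push_cast; ring
  have hvγ : v γ = d - m * d := by
    have := hvw γ hγ0
    rw [hγn, hσA] at this
    linarith
  have hvβ : v β = m * d := by
    have h0 := polyAtInfty_ne_zero hτu.ne_zero
    have hlt : (polyAtInfty F r + s).orderTop < (polyAtInfty F τ).orderTop := by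
      rw [← HahnSeries.order_eq_orderTop_of_ne_zero hrs0,
        ← HahnSeries.order_eq_orderTop_of_ne_zero h0, WithTop.coe_lt_coe, hrs,
        order_polyAtInfty hτu.ne_zero, Polynomial.natDegree_eq_zero_of_isUnit hτu, hr]
      have : 0 < m * d := by omega
      omega
    have h1 := HahnSeries.orderTop_add_eq_left hlt
    have hφ : quadAtInfty s hs β = polyAtInfty F r + s + polyAtInfty F τ := by
      simp [quadAtInfty_apply, β]; ring
    rw [← hφ, ← HahnSeries.order_eq_orderTop_of_ne_zero hrs0,
      ← HahnSeries.order_eq_orderTop_of_ne_zero (hne β hβ0).1, WithTop.coe_inj] at h1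
    simp only [hvdef, h1, hrs, hr]
    push_cast; ring
  have hwβ : w β = 0 := by
    have := hvw β hβ0
    rw [hβn, Polynomial.natDegree_mul (mul_ne_zero h2u.ne_zero hτu.ne_zero) (pow_ne_zero _ hA0),
      Polynomial.natDegree_eq_zero_of_isUnit (h2u.mul hτu), Polynomial.natDegree_pow, hvβ] at this
    push_cast at this
    linarith
  have hγm : (γ ^ m).norm ≠ 0 := by rw [map_pow]; exact pow_ne_zero _ hγ0
  have hεn := QuadraticAlgebra.norm_unit_ne_zero ε
  have hvε : v ε = m * (m * d) := by
    have := hv _ _ hγm hεn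
    rw [← he, hvβ, map_pow_of_norm hv hγ0, hvγ] at this
    linear_combination -this
  have hwε : w ε = -(m * (m * d)) := by
    have := hw _ _ hγm hεn
    rw [← he, hwβ, map_pow_of_norm hw hγ0, hwγ] at this
    linear_combination -this
  obtain ⟨k, j, x, hx⟩ := exists_mul_eq_algebraMap_of_degrees hm hv hw hvw him hγ0 hvγ hwγ ε
    hvε hwε hz hzd
  have hαdvd : α ^ j ∣ ι x := by
    have h := congrArg star hx
    have hst : star γ = α := by apply QuadraticAlgebra.ext <;> simp [α, γ]
    have hsx : star (ι x) = ι x := by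
      apply QuadraticAlgebra.ext <;> simp [ι, QuadraticAlgebra.algebraMap_eq]
    rw [star_mul, star_pow, hst, hsx] at h
    exact ⟨_, h.symm⟩
  have hγdvd : γ ^ j ∣ ι x := ⟨_, by rw [mul_comm]; exact hx.symm⟩
  have hAm : ι A ^ m = ι A ^ (m - 1) * ι A := by rw [← pow_succ]; congr 1; omega
  -- Both `A` and `A ^ m` are multiples of `α * γ`, so `α + γ` is congruent to the unit `-τ` modulo
  -- `α * γ`.
  have hcop' : IsCoprime α γ := by
    refine ⟨-ι τ, -ι τ + (2 * ι τ * ι A ^ (m - 1) - ι σ) * ι σ * α, ?_⟩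
    rw [hAm] at hsum
    linear_combination -ι τ * hsum - (2 * ι τ * ι A ^ (m - 1) - ι σ) * hAαγ +
      (1 + ι σ * ι A) * hστ.2
  have hdvd : A ^ j ∣ x := by
    apply QuadraticAlgebra.algebraMap_dvd_algebraMap (a := D) (b := 0)
    refine dvd_trans ?_ (hcop'.pow.mul_dvd hαdvd hγdvd)
    rw [← mul_pow, hαγ, ← map_pow]
    exact map_dvd ι (pow_dvd_pow_of_dvd (dvd_mul_left A σ) j)
  have hεk := QuadraticAlgebra.norm_unit_ne_zero (ε ^ k)
  have hγj : γ.norm ^ j ≠ 0 := pow_ne_zero _ hγ0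
  have hnorm := congrArg (fun y => (QuadraticAlgebra.norm y).natDegree) hx
  have hx0 : x ≠ 0 := by
    rintro rfl
    have := congrArg QuadraticAlgebra.norm hx
    rw [map_mul, map_mul, map_pow, QuadraticAlgebra.norm_algebraMap] at this
    exact mul_ne_zero (mul_ne_zero hz hεk) hγj (by rw [this]; simp)
  simp only [map_mul, map_pow, QuadraticAlgebra.norm_algebraMap] at hnorm
  rw [Polynomial.natDegree_mul (mul_ne_zero hz hεk) hγj, Polynomial.natDegree_mul hz hεk,
    Polynomial.natDegree_eq_zero_of_isUnit
      (QuadraticAlgebra.isUnit_iff_norm_isUnit.mp (ε ^ k).isUnit),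
    Polynomial.natDegree_pow, Polynomial.natDegree_pow, hγn, hσA] at hnorm
  have hle := Polynomial.natDegree_le_of_dvd hdvd hx0
  rw [Polynomial.natDegree_pow, ← hd] at hle
  -- Norms give `2 * deg x = deg (norm z) + j * d < (j + 1) * d`, while `A ^ j ∣ x` gives `deg x ≥ j
  -- * d`; hence `j < 1`.
  have hj : j = 0 := by
    by_contra hj
    have := Nat.le_mul_of_pos_left d (Nat.pos_of_ne_zero hj)
    omega
  subst hj
  exact ⟨ε ^ k, x, by simpa using hx⟩

/-- A power of a split prime over `P` of such an order is not principal while its norm has degree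
smaller than that of `A`. -/
theorem natDegree_le_of_span_pow_eq_span (h2 : (2 : F) ≠ 0) {r A σ τ P b : F[X]} {m : ℕ}
    (hm : 1 ≤ m) (hσ : σ ^ 2 = 1) (hτ : τ ^ 2 = 1) (hA : 0 < A.natDegree)
    (hD : D = r ^ 2 - σ * A) (h2r : 2 * r = 2 * A ^ m - τ - τ * σ * A)
    (hr : r.natDegree = m * A.natDegree) (hP : Irreducible P) (hPD : P ∣ D - b ^ 2)
    (hPb : ¬ P ∣ 2 * b) {t : ℕ} (ht : 0 < t) {z : QuadraticAlgebra F[X] D 0}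
    (hz : Ideal.span {algebraMap F[X] (QuadraticAlgebra F[X] D 0) P, ⟨-b, 1⟩} ^ t =
      Ideal.span {z}) : A.natDegree ≤ t * P.natDegree := by
  set ι : F[X] →+* (QuadraticAlgebra F[X] D 0) := algebraMap F[X] (QuadraticAlgebra F[X] D 0) with hι
  obtain ⟨c, hc⟩ := hPD
  have hmul : Ideal.span {ι P, ⟨-b, 1⟩} * Ideal.span {ι P, ⟨-b, -1⟩} =
      Ideal.span {ι P} := by
    apply le_antisymm
    · rw [Ideal.span_mul_span']
      rw [Ideal.span_le]
      rintro _ ⟨x, hx, y, hy, rfl⟩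
      simp only [SetLike.mem_coe, Ideal.mem_span_singleton]
      rcases hx with rfl | rfl
      · exact dvd_mul_right _ _
      · rcases hy with rfl | rfl
        · exact dvd_mul_left _ _
        · refine ⟨ι (-c), ?_⟩
          have h' : b ^ 2 - D = P * (-c) := by linear_combination -hc
          apply QuadraticAlgebra.ext
          · simp [hι, QuadraticAlgebra.algebraMap_eq]; linear_combination h'
          · simp [hι, QuadraticAlgebra.algebraMap_eq]
    · have hcop : IsCoprime P (2 * b) := (hP.coprime_iff_not_dvd).mpr hPb
      obtain ⟨f, g, hfg⟩ := hcop
      rw [Ideal.span_singleton_le_iff_mem]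
      have m1 : ι P ∈ Ideal.span {ι P, (⟨-b, 1⟩ : QuadraticAlgebra F[X] D 0)} :=
        Ideal.subset_span (by simp)
      have m2 : (⟨-b, 1⟩ : QuadraticAlgebra F[X] D 0) ∈ Ideal.span {ι P, ⟨-b, 1⟩} :=
        Ideal.subset_span (by simp)
      have m3 : ι P ∈ Ideal.span {ι P, (⟨-b, -1⟩ : QuadraticAlgebra F[X] D 0)} :=
        Ideal.subset_span (by simp)
      have m4 : (⟨-b, -1⟩ : QuadraticAlgebra F[X] D 0) ∈ Ideal.span {ι P, ⟨-b, -1⟩} :=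
        Ideal.subset_span (by simp)
      -- The Bézout relation `f * P + g * (2 * b) = 1` multiplied by `P`, with `-2 * b * P` written
      -- as a sum of products of generators.
      have hsum : ι P = ι f * (ι P * ι P) +
          ι (-g) * (ι P * ⟨-b, -1⟩ + ⟨-b, 1⟩ * ι P) := by
        apply QuadraticAlgebra.ext
        · simp [hι, QuadraticAlgebra.algebraMap_eq]; linear_combination -P * hfg
        · simp [hι, QuadraticAlgebra.algebraMap_eq]
      have hmem := add_mem (Ideal.mul_mem_left _ (ι f) (Ideal.mul_mem_mul m1 m3))
        (Ideal.mul_mem_left _ (ι (-g)) (add_mem (Ideal.mul_mem_mul m1 m4) (Ideal.mul_mem_mul m2 m3)))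
      rw [← hsum] at hmem
      exact hmem
  have hstar : Ideal.span {ι P, ⟨-b, -1⟩} ^ t = Ideal.span {star z} := by
    have h := congrArg (Ideal.map (starRingEnd (QuadraticAlgebra F[X] D 0))) hz
    rw [Ideal.map_pow, Ideal.map_span, Ideal.map_span, Set.image_pair, Set.image_singleton] at h
    have e1 : starRingEnd (QuadraticAlgebra F[X] D 0) (ι P) = ι P := by
      apply QuadraticAlgebra.ext <;> simp [starRingEnd_apply, hι, QuadraticAlgebra.algebraMap_eq]
    have e2 : starRingEnd (QuadraticAlgebra F[X] D 0) ⟨-b, 1⟩ = ⟨-b, -1⟩ := by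
      apply QuadraticAlgebra.ext <;> simp [starRingEnd_apply]
    rwa [e1, e2] at h
  have hassoc : Ideal.span {ι (P ^ t)} = Ideal.span {ι z.norm} := by
    rw [map_pow, ← Ideal.span_singleton_pow, ← hmul, mul_pow, hz, hstar,
      Ideal.span_singleton_mul_span_singleton, hι, QuadraticAlgebra.algebraMap_norm_eq_mul_star]
  have hassoc' : Associated (P ^ t) z.norm := by
    apply associated_of_dvd_dvd
    · apply QuadraticAlgebra.algebraMap_dvd_algebraMap (a := D) (b := 0)
      rw [← Ideal.span_singleton_le_span_singleton]; exact hassoc.ge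
    · apply QuadraticAlgebra.algebraMap_dvd_algebraMap (a := D) (b := 0)
      rw [← Ideal.span_singleton_le_span_singleton]; exact hassoc.le
  have hz0 : z.norm ≠ 0 := hassoc'.ne_zero_iff.mp (pow_ne_zero _ hP.ne_zero)
  by_contra hlt
  have hzdeg : z.norm.natDegree = t * P.natDegree := by
    rw [← Polynomial.natDegree_pow]
    exact (Polynomial.natDegree_eq_of_degree_eq
      (Polynomial.degree_eq_degree_of_associated hassoc')).symm
  obtain ⟨u, x, hx⟩ := exists_unit_mul_eq_algebraMap h2 hm hσ hτ hA hD h2r hr hz0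
    (by rw [hzdeg]; omega)
  have hPx : P ∣ x := by
    apply hP.prime.dvd_of_dvd_pow (n := 2)
    rw [← QuadraticAlgebra.norm_algebraMap (a := D) (b := 0), ← hx, map_mul]
    exact ((dvd_pow_self P ht.ne').trans hassoc'.dvd).mul_right _
  have hmem : (⟨-b, 1⟩ : QuadraticAlgebra F[X] D 0) ^ t ∈ Ideal.span {z} := by
    rw [← hz]
    exact Ideal.pow_mem_pow (Ideal.subset_span (by simp)) t
  have hPdvd : ι P ∣ (⟨-b, 1⟩ : QuadraticAlgebra F[X] D 0) ^ t := by
    refine dvd_trans ?_ (Ideal.mem_span_singleton.mp hmem)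
    have : ι P ∣ z * u := by rw [hx]; exact map_dvd ι hPx
    exact (Units.dvd_mul_right).mp this
  have : Fact (Irreducible P) := ⟨hP⟩
  let q : F[X] →+* AdjoinRoot P := AdjoinRoot.mk P
  have hqD : q D = q b ^ 2 := by
    rw [← map_pow, ← sub_eq_zero, ← map_sub, hc]
    exact AdjoinRoot.mk_eq_zero.mpr (dvd_mul_right _ _)
  -- Reduction modulo the conjugate prime, `√D ↦ -b`: it kills `P` but sends `√D - b` to `-2 * b`,
  -- which is nonzero modulo `P`.
  let ψ : (QuadraticAlgebra F[X] D 0) →+* AdjoinRoot P :=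
    { toFun := fun y => q y.re - q y.im * q b
      map_one' := by simp [QuadraticAlgebra.re_one, QuadraticAlgebra.im_one]
      map_zero' := by simp
      map_add' := fun y y' => by simp; ring
      map_mul' := fun y y' => by
        simp only [QuadraticAlgebra.re_mul, QuadraticAlgebra.im_mul, map_add, map_mul, map_zero,
          hqD]
        ring }
  have h := map_dvd ψ hPdvd
  have h1 : ψ (ι P) = 0 := by
    change q P - q 0 * q b = 0
    rw [map_zero, zero_mul, sub_zero]; exact AdjoinRoot.mk_self
  rw [h1, zero_dvd_iff, map_pow] at h
  have h3 := pow_eq_zero_iff ht.ne' |>.mp h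
  have h4 : q (2 * b) = 0 := by
    have h5 : q (-b) - q 1 * q b = 0 := h3
    simp only [map_neg, map_one, one_mul] at h5
    rw [map_mul, map_ofNat]; linear_combination -h5
  exact hPb (AdjoinRoot.mk_eq_zero.mp h4)

end SmallNorm

/-! ### The integral closure of `F[X]` in `k(√D)`. -/

section RingOfIntegers

theorem RatFunc.sq_ne_of_squarefree {F : Type*} [Field F] {D : F[X]} (hD : Squarefree D)
    (hdeg : 0 < D.natDegree) (x : RatFunc F) : x ^ 2 ≠ algebraMap F[X] (RatFunc F) D := by
  intro h
  have hx : IsIntegral F[X] x := by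
    apply IsIntegral.of_pow two_pos
    rw [h]; exact isIntegral_algebraMap
  obtain ⟨p, rfl⟩ := IsIntegrallyClosed.isIntegral_iff.mp hx
  rw [← map_pow] at h
  have h' := IsFractionRing.injective F[X] (RatFunc F) h
  have := hD p ⟨1, by rw [← h']; ring⟩
  rw [← h', Polynomial.natDegree_pow, Polynomial.natDegree_eq_zero_of_isUnit this] at hdeg
  simp at hdeg

variable {F : Type*} [Field F] {K : Type*} [Field K] [Algebra F[X] K] {D : F[X]} {δ : K}

/-- The `F[X]`-algebra map from `F[X][√D]` to `K` determined by a square root of `D` in `K`. -/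
noncomputable def quadLift (hδ : δ ^ 2 = algebraMap F[X] K D) :
    QuadraticAlgebra F[X] D 0 →ₐ[F[X]] K :=
  QuadraticAlgebra.lift ⟨δ, by rw [zero_smul, add_zero, ← sq, hδ, Algebra.algebraMap_eq_smul_one]⟩

theorem quadLift_apply (hδ : δ ^ 2 = algebraMap F[X] K D) (z : QuadraticAlgebra F[X] D 0) :
    quadLift hδ z = algebraMap F[X] K z.re + algebraMap F[X] K z.im * δ := by
  simp [quadLift, QuadraticAlgebra.lift, Algebra.smul_def]

variable [Algebra (RatFunc F) K] [IsScalarTower F[X] (RatFunc F) K]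

theorem exists_eq_add_mul_of_adjoin_eq_top (hδ : δ ^ 2 = algebraMap F[X] K D)
    (hK : IntermediateField.adjoin (RatFunc F) {δ} = ⊤) (hD : Squarefree D)
    (hdeg : 0 < D.natDegree) :
    ∃ Φ : QuadraticAlgebra (RatFunc F) (algebraMap F[X] (RatFunc F) D) 0 ≃ₐ[RatFunc F] K,
      ∀ z, Φ z = algebraMap (RatFunc F) K z.re + algebraMap (RatFunc F) K z.im * δ := by
  have hfact : Fact (∀ r : RatFunc F, r ^ 2 ≠ algebraMap F[X] (RatFunc F) D + 0 * r) :=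
    ⟨fun r => by rw [zero_mul, add_zero]; exact RatFunc.sq_ne_of_squarefree hD hdeg r⟩
  let f : QuadraticAlgebra (RatFunc F) (algebraMap F[X] (RatFunc F) D) 0 →ₐ[RatFunc F] K :=
    QuadraticAlgebra.lift ⟨δ, by
      rw [zero_smul, add_zero, ← sq, hδ, ← Algebra.algebraMap_eq_smul_one,
        ← IsScalarTower.algebraMap_apply]⟩
  have hf : ∀ z, f z = algebraMap (RatFunc F) K z.re + algebraMap (RatFunc F) K z.im * δ := by
    intro z; simp [f, QuadraticAlgebra.lift, Algebra.smul_def]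
  have hsurj : Function.Surjective f := by
    rw [← AlgHom.fieldRange_eq_top, ← top_le_iff, ← hK, IntermediateField.adjoin_le_iff,
      Set.singleton_subset_iff]
    exact ⟨⟨0, 1⟩, by change f _ = δ; rw [hf]; simp⟩
  exact ⟨AlgEquiv.ofBijective f ⟨f.toRingHom.injective, hsurj⟩, hf⟩

theorem quadLift_injective (hδ : δ ^ 2 = algebraMap F[X] K D)
    (hK : IntermediateField.adjoin (RatFunc F) {δ} = ⊤) (hD : Squarefree D)
    (hdeg : 0 < D.natDegree) : Function.Injective (quadLift hδ) := by
  obtain ⟨Φ, hΦ⟩ := exists_eq_add_mul_of_adjoin_eq_top hδ hK hD hdeg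
  intro x y hxy
  have key : ∀ z : QuadraticAlgebra F[X] D 0, quadLift hδ z =
      Φ ⟨algebraMap F[X] (RatFunc F) z.re, algebraMap F[X] (RatFunc F) z.im⟩ := by
    intro z
    rw [hΦ, quadLift_apply, ← IsScalarTower.algebraMap_apply, ← IsScalarTower.algebraMap_apply]
  rw [key, key] at hxy
  have h := Φ.injective hxy
  rw [QuadraticAlgebra.mk.injEq] at h
  have hinj := IsFractionRing.injective F[X] (RatFunc F)
  exact QuadraticAlgebra.ext (hinj h.1) (hinj h.2)

/-- The trace `2 * w.re` is integral and `2` is a unit, so `w.re` is a polynomial. The norm then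
makes `D * w.im ^ 2` a polynomial `n`, so `u = D * w.im` is one too. From `u ^ 2 = D * n` and `D`
square-free, `D ∣ u`. -/
theorem exists_quadLift_eq_of_isIntegral (h2 : (2 : F) ≠ 0) (hδ : δ ^ 2 = algebraMap F[X] K D)
    (hK : IntermediateField.adjoin (RatFunc F) {δ} = ⊤) (hD : Squarefree D)
    (hdeg : 0 < D.natDegree) {x : K} (hx : IsIntegral F[X] x) : ∃ z, quadLift hδ z = x := by
  obtain ⟨Φ, hΦ⟩ := exists_eq_add_mul_of_adjoin_eq_top hδ hK hD hdeg
  obtain ⟨w, rfl⟩ := Φ.surjective x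
  let E := QuadraticAlgebra (RatFunc F) (algebraMap F[X] (RatFunc F) D) 0
  have hinjE : Function.Injective (algebraMap (RatFunc F) E) := QuadraticAlgebra.C_injective
  have hw : IsIntegral F[X] w :=
    (isIntegral_algHom_iff (Φ.toAlgHom.restrictScalars F[X]) Φ.injective).mp hx
  let conj : E →ₐ[F[X]] E :=
    { starRingEnd E with
      commutes' := fun p => by
        apply QuadraticAlgebra.ext
        · change (algebraMap F[X] E p).re + 0 * (algebraMap F[X] E p).im = (algebraMap F[X] E p).re
          rw [zero_mul, add_zero]
        · change -(algebraMap (RatFunc F) E (algebraMap F[X] (RatFunc F) p)).im =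
            (algebraMap (RatFunc F) E (algebraMap F[X] (RatFunc F) p)).im
          simp [E, QuadraticAlgebra.algebraMap_eq] }
  have hw' : IsIntegral F[X] (star w : E) := hw.map conj
  have htr : IsIntegral F[X] (2 * w.re) := by
    rw [← isIntegral_algebraMap_iff hinjE]
    convert hw.add hw' using 1
    apply QuadraticAlgebra.ext
    · simp [E, QuadraticAlgebra.algebraMap_eq]; ring
    · simp [E, QuadraticAlgebra.algebraMap_eq]
  have h2u : IsUnit (2 : F[X]) := by
    rw [← map_ofNat Polynomial.C 2]
    exact Polynomial.isUnit_C.mpr h2.isUnit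
  have hre : IsIntegral F[X] w.re := by
    obtain ⟨u, hu⟩ := h2u
    have h := (isIntegral_algebraMap (R := F[X]) (A := RatFunc F) (x := ((u⁻¹ : F[X]ˣ) : F[X]))).mul
      htr
    have h2' : algebraMap F[X] (RatFunc F) ((u⁻¹ : F[X]ˣ) : F[X]) * 2 = 1 := by
      rw [← map_ofNat (algebraMap F[X] (RatFunc F)) 2, ← hu, ← map_mul, Units.inv_mul, map_one]
    rwa [← mul_assoc, h2', one_mul] at h
  have hnorm : IsIntegral F[X] w.norm := by
    rw [← isIntegral_algebraMap_iff hinjE, QuadraticAlgebra.algebraMap_norm_eq_mul_star]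
    exact hw.mul hw'
  obtain ⟨p, hp⟩ := IsIntegrallyClosed.isIntegral_iff.mp hre
  have hDi : IsIntegral F[X] (algebraMap F[X] (RatFunc F) D * w.im ^ 2) := by
    have h : algebraMap F[X] (RatFunc F) D * w.im ^ 2 = w.re ^ 2 - w.norm := by
      rw [QuadraticAlgebra.norm_def]; ring
    rw [h]
    exact (hre.pow 2).sub hnorm
  obtain ⟨n, hn⟩ := IsIntegrallyClosed.isIntegral_iff.mp hDi
  have hDim : IsIntegral F[X] (algebraMap F[X] (RatFunc F) D * w.im) := by
    apply IsIntegral.of_pow two_pos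
    rw [mul_pow, sq (algebraMap F[X] (RatFunc F) D), mul_assoc, ← hn, ← map_mul]
    exact isIntegral_algebraMap
  obtain ⟨u, hu⟩ := IsIntegrallyClosed.isIntegral_iff.mp hDim
  have hinj := IsFractionRing.injective F[X] (RatFunc F)
  have hDu : D ∣ u := by
    apply hD.isRadical 2 u
    refine ⟨n, hinj ?_⟩
    rw [map_pow, map_mul, hu, hn]; ring
  obtain ⟨c, rfl⟩ := hDu
  have hc : algebraMap F[X] (RatFunc F) c = w.im := by
    rw [map_mul] at hu
    exact mul_left_cancel₀ ((map_ne_zero_iff _ hinj).mpr hD.ne_zero) hu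
  refine ⟨⟨p, c⟩, ?_⟩
  rw [hΦ, ← hp, ← hc, quadLift_apply, ← IsScalarTower.algebraMap_apply,
    ← IsScalarTower.algebraMap_apply]

/-- For square-free `D`, the ring of integers of `k(√D)` is `F[X][√D]`. -/
theorem nonempty_quadraticAlgebra_ringEquiv_ringOfIntegers (h2 : (2 : F) ≠ 0)
    (hδ : δ ^ 2 = algebraMap F[X] K D)
    (hK : IntermediateField.adjoin (RatFunc F) {δ} = ⊤) (hD : Squarefree D)
    (hdeg : 0 < D.natDegree) :
    Nonempty (QuadraticAlgebra F[X] D 0 ≃+* FunctionField.ringOfIntegers F K) := by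
  let f : QuadraticAlgebra F[X] D 0 →ₐ[F[X]] FunctionField.ringOfIntegers F K :=
    (quadLift hδ).codRestrict _ fun z => (Algebra.IsIntegral.isIntegral z).map (quadLift hδ)
  refine ⟨RingEquiv.ofBijective f ⟨?_, ?_⟩⟩
  · exact (AlgHom.injective_codRestrict _ _ _).mpr (quadLift_injective hδ hK hD hdeg)
  · rintro ⟨x, hx⟩
    obtain ⟨z, rfl⟩ := exists_quadLift_eq_of_isIntegral h2 hδ hK hD hdeg hx
    exact ⟨z, rfl⟩

theorem finiteDimensional_of_adjoin_sqrt (hδ : δ ^ 2 = algebraMap F[X] K D)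
    (hK : IntermediateField.adjoin (RatFunc F) {δ} = ⊤) : FiniteDimensional (RatFunc F) K := by
  have hint : IsIntegral (RatFunc F) δ := by
    apply IsIntegral.of_pow two_pos
    rw [hδ, IsScalarTower.algebraMap_apply F[X] (RatFunc F) K]
    exact isIntegral_algebraMap
  have := IntermediateField.adjoin.finiteDimensional hint
  rw [hK] at this
  exact Module.Finite.equiv (IntermediateField.topEquiv (F := RatFunc F) (E := K)).toLinearEquiv

theorem isSeparable_of_adjoin_sqrt (h2 : (2 : F) ≠ 0) (hδ : δ ^ 2 = algebraMap F[X] K D)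
    (hK : IntermediateField.adjoin (RatFunc F) {δ} = ⊤) (hD : D ≠ 0) :
    Algebra.IsSeparable (RatFunc F) K := by
  have h2' : ((2 : ℕ) : RatFunc F) ≠ 0 := by
    have := (algebraMap F (RatFunc F)).injective.ne h2
    rwa [map_ofNat, map_zero] at this
  have hsep : IsSeparable (RatFunc F) δ := by
    refine (Polynomial.separable_X_pow_sub_C (algebraMap F[X] (RatFunc F) D) h2'
      ((map_ne_zero_iff _ (IsFractionRing.injective F[X] (RatFunc F))).mpr hD)).of_dvd
      (minpoly.dvd _ _ ?_)
    simp [hδ, ← IsScalarTower.algebraMap_apply]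
  have := (IntermediateField.isSeparable_adjoin_simple_iff_isSeparable (RatFunc F) K).mpr hsep
  rw [hK] at this
  exact (AlgEquiv.Algebra.isSeparable_iff
    (IntermediateField.topEquiv (F := RatFunc F) (E := K))).mp this

end RingOfIntegers

/-! ### The class number bound and the four families. -/

theorem exists_pow_isPrincipal_le_card_classGroup {R : Type*} [CommRing R] [IsDedekindDomain R]
    [Finite (ClassGroup R)] {I : Ideal R} (hI : I ≠ ⊥) :
    ∃ t, 0 < t ∧ t ≤ Nat.card (ClassGroup R) ∧ (I ^ t).IsPrincipal := by
  have hI' : I ∈ nonZeroDivisors (Ideal R) := mem_nonZeroDivisors_of_ne_zero hI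
  refine ⟨orderOf (ClassGroup.mk0 ⟨I, hI'⟩), orderOf_pos _, orderOf_le_card, ?_⟩
  rw [← ClassGroup.mk0_eq_one_iff (pow_mem hI' _)]
  have := pow_orderOf_eq_one (ClassGroup.mk0 ⟨I, hI'⟩)
  rw [← map_pow] at this
  exact this

/-- Only `m = 1` allows the leading terms to cancel, through the coefficient `2 + c`. In forms (1)
and (3) `c = 1`, which is why characteristic 3 is excluded there; in (2) and (4) `c = -1` and `2 + c
= 1`. -/
theorem natDegree_eq_of_two_mul_eq {F : Type*} [Field F] (h2 : (2 : F) ≠ 0) {A r : F[X]} {m : ℕ}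
    (hm : 1 ≤ m) (hA : 0 < A.natDegree) {c e : F}
    (h : 2 * r = 2 * A ^ m + Polynomial.C c * A + Polynomial.C e) (hc : m = 1 → 2 + c ≠ 0) :
    r.natDegree = m * A.natDegree := by
  have hC : (2 : F[X]) = Polynomial.C 2 := (map_ofNat Polynomial.C 2).symm
  rw [← Polynomial.natDegree_C_mul h2, ← hC, h, Polynomial.natDegree_add_C]
  rcases hm.eq_or_lt with rfl | hm
  · rw [pow_one, hC, ← add_mul, ← map_add, Polynomial.natDegree_C_mul (hc rfl), one_mul]
  · have h1 : (2 * A ^ m).natDegree = m * A.natDegree := by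
      rw [hC, Polynomial.natDegree_C_mul h2, Polynomial.natDegree_pow]
    rw [Polynomial.natDegree_add_eq_left_of_natDegree_lt, h1]
    rw [h1]
    calc (Polynomial.C c * A).natDegree ≤ A.natDegree := Polynomial.natDegree_C_mul_le _ _
      _ < m * A.natDegree := by nlinarith

theorem natDegree_le_idealClassNumber_mul {F : Type*} [Field F] [Finite F] (h2 : (2 : F) ≠ 0)
    {K : Type*} [Field K] [Algebra F[X] K] [Algebra (RatFunc F) K]
    [IsScalarTower F[X] (RatFunc F) K] {D r A P b σ τ : F[X]} {m : ℕ} (hm : 1 ≤ m)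
    (hσ : σ ^ 2 = 1) (hτ : τ ^ 2 = 1) (hA : 0 < A.natDegree)
    (hD : D = r ^ 2 - σ * A) (h2r : 2 * r = 2 * A ^ m - τ - τ * σ * A)
    (hr : r.natDegree = m * A.natDegree) (hP : Irreducible P) (hPD : P ∣ D - b ^ 2)
    (hPb : ¬ P ∣ 2 * b) (hDsf : Squarefree D)
    {δ : K} (hδ : δ ^ 2 = algebraMap F[X] K D)
    (hK : IntermediateField.adjoin (RatFunc F) {δ} = ⊤) :
    A.natDegree ≤ idealClassNumber F K * P.natDegree := by
  have hDdeg : 0 < D.natDegree := by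
    have hσ0 : σ.natDegree = 0 :=
      Polynomial.natDegree_eq_zero_of_isUnit (IsUnit.of_pow_eq_one hσ two_ne_zero)
    have h1 : A.natDegree ≤ m * A.natDegree := Nat.le_mul_of_pos_left _ hm
    have h3 : (σ * A).natDegree < (r ^ 2).natDegree := by
      rw [Polynomial.natDegree_pow]
      have := Polynomial.natDegree_mul_le (p := σ) (q := A)
      omega
    rw [hD, Polynomial.natDegree_sub_eq_left_of_natDegree_lt h3]
    omega
  have := Fintype.ofFinite F
  have : FunctionField F K := finiteDimensional_of_adjoin_sqrt hδ hK
  have := isSeparable_of_adjoin_sqrt h2 hδ hK hDsf.ne_zero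
  obtain ⟨e⟩ := nonempty_quadraticAlgebra_ringEquiv_ringOfIntegers h2 hδ hK hDsf hDdeg
  set I : Ideal (QuadraticAlgebra F[X] D 0) :=
    Ideal.span {algebraMap F[X] (QuadraticAlgebra F[X] D 0) P, ⟨-b, 1⟩} with hI
  have hI0 : I.map e ≠ ⊥ := by
    rw [Ne, Ideal.map_eq_bot_iff_of_injective e.injective, hI, Ideal.span_eq_bot]
    intro h
    have := congrArg QuadraticAlgebra.im (h ⟨-b, 1⟩ (by simp))
    simp at this
  obtain ⟨t, ht, hth, ⟨y, hy⟩⟩ := exists_pow_isPrincipal_le_card_classGroup hI0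
  have hz : I ^ t = Ideal.span {e.symm y} := by
    have h := congrArg (Ideal.map e.symm) hy
    rw [← Ideal.map_pow, Ideal.submodule_span_eq, Ideal.map_span, Set.image_singleton] at h
    rw [← h]
    exact (Ideal.map_of_equiv e).symm
  exact (natDegree_le_of_span_pow_eq_span h2 hm hσ hτ hA hD h2r hr hP hPD hPb ht hz).trans
    (Nat.mul_le_mul_right _ hth)

theorem corollary3 {Fq : Type*} [Field Fq] [Finite Fq] (hq : ringChar Fq ≠ 2)
    {K : Type*} [Field K] [Algebra Fq[X] K] [Algebra (RatFunc Fq) K]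
    [IsScalarTower Fq[X] (RatFunc Fq) K]
    (a A S P D : Fq[X]) (m : ℕ) (hm : 1 ≤ m)
    (ha : 0 < a.natDegree) (hA : A = 2 * a + 1) (hAmonic : A.Monic)
    (hP : Irreducible P) (hASP : A = S * P) (hS : 2 ≤ S.natDegree)
    (hDsf : Squarefree D)
    (hD : ((D = (A ^ m + a) ^ 2 + A ∨ D = (A ^ m + a + 1) ^ 2 - A) ∧
              ¬ (m = 1 ∧ ringChar Fq = 3)) ∨
          D = (A ^ m - a) ^ 2 + A ∨
          D = (A ^ m - a - 1) ^ 2 - A)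
    (δ : K) (hδ : δ ^ 2 = algebraMap Fq[X] K D)
    (hK : IntermediateField.adjoin (RatFunc Fq) {δ} = ⊤) :
    ((S * P).natDegree : ℚ) / (P.natDegree : ℚ) ≤ (idealClassNumber Fq K : ℚ) ∧
      1 < ((S * P).natDegree : ℚ) / (P.natDegree : ℚ) ∧
      1 < idealClassNumber Fq K := by
  have h2 : (2 : Fq) ≠ 0 := Ring.two_ne_zero hq
  have hPdeg : 0 < P.natDegree := hP.natDegree_pos
  have hS0 : S ≠ 0 := by rintro rfl; simp at hS
  have hAdeg : A.natDegree = S.natDegree + P.natDegree := by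
    rw [hASP, Polynomial.natDegree_mul hS0 hP.ne_zero]
  have hA0 : 0 < A.natDegree := by omega
  have hPA : P ∣ A := ⟨S, by rw [hASP, mul_comm]⟩
  have hAm : P ∣ A ^ m := dvd_pow hPA (by omega)
  have h3 : ¬ (m = 1 ∧ ringChar Fq = 3) → m = 1 → (2 : Fq) + 1 ≠ 0 := by
    intro h hm1 h0
    apply h ⟨hm1, ?_⟩
    have h0' : ((3 : ℕ) : Fq) = 0 := by push_cast; linear_combination h0
    have hdvd := (ringChar.spec Fq 3).mp h0'
    rcases (Nat.dvd_prime Nat.prime_three).mp hdvd with h1 | h1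
    · exact absurd h1 (CharP.ringChar_ne_one)
    · exact h1
  -- Modulo `P` the root of `D` is `b = a` in forms (1), (2) and `b = a + 1` in (3), (4). As `2 * a
  -- = A - 1` and `2 * (a + 1) = A + 1`, `2 * b` is `∓1` modulo `P`.
  have hPa : ¬ P ∣ 2 * a := fun h => hP.not_isUnit (isUnit_of_dvd_one (by
    have := dvd_sub hPA h
    rwa [hA, add_sub_cancel_left] at this))
  have hPa' : ¬ P ∣ 2 * (a + 1) := fun h => hP.not_isUnit (isUnit_of_dvd_one (by
    have := dvd_sub h hPA
    rwa [hA, show 2 * (a + 1) - (2 * a + 1) = 1 by ring] at this))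
  have hmain : A.natDegree ≤ idealClassNumber Fq K * P.natDegree := by
    rcases hD with ⟨h | h, hex⟩ | h | h
    · have h2r : 2 * (A ^ m + a) = 2 * A ^ m - 1 - 1 * (-1) * A := by rw [hA]; ring
      refine natDegree_le_idealClassNumber_mul h2 (r := A ^ m + a) (b := a) (σ := -1) (τ := 1) hm
        (by ring) (by ring) hA0 (by rw [h]; ring) h2r
        (natDegree_eq_of_two_mul_eq h2 hm hA0 (c := 1) (e := -1)
          (by rw [h2r]; simp; ring) (h3 hex)) hP ?_ hPa hDsf hδ hK
      rw [h, show (A ^ m + a) ^ 2 + A - a ^ 2 = A ^ m * (A ^ m + 2 * a) + A by ring]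
      exact dvd_add (hAm.mul_right _) hPA
    · have h2r : 2 * (A ^ m + a + 1) = 2 * A ^ m - (-1) - (-1) * 1 * A := by rw [hA]; ring
      refine natDegree_le_idealClassNumber_mul h2 (r := A ^ m + a + 1) (b := a + 1) (σ := 1)
        (τ := -1) hm (by ring) (by ring) hA0 (by rw [h]; ring) h2r
        (natDegree_eq_of_two_mul_eq h2 hm hA0 (c := 1) (e := 1)
          (by rw [h2r]; simp; ring) (h3 hex)) hP ?_ hPa' hDsf hδ hK
      rw [h, show (A ^ m + a + 1) ^ 2 - A - (a + 1) ^ 2 =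
        A ^ m * (A ^ m + 2 * (a + 1)) - A by ring]
      exact dvd_sub (hAm.mul_right _) hPA
    · have h2r : 2 * (A ^ m - a) = 2 * A ^ m - (-1) - (-1) * (-1) * A := by rw [hA]; ring
      refine natDegree_le_idealClassNumber_mul h2 (r := A ^ m - a) (b := a) (σ := -1) (τ := -1) hm
        (by ring) (by ring) hA0 (by rw [h]; ring) h2r
        (natDegree_eq_of_two_mul_eq h2 hm hA0 (c := -1) (e := 1)
          (by rw [h2r]; simp; ring) (fun _ => by norm_num)) hP ?_ hPa hDsf hδ hK
      rw [h, show (A ^ m - a) ^ 2 + A - a ^ 2 = A ^ m * (A ^ m - 2 * a) + A by ring]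
      exact dvd_add (hAm.mul_right _) hPA
    · have h2r : 2 * (A ^ m - a - 1) = 2 * A ^ m - 1 - 1 * 1 * A := by rw [hA]; ring
      refine natDegree_le_idealClassNumber_mul h2 (r := A ^ m - a - 1) (b := a + 1) (σ := 1)
        (τ := 1) hm (by ring) (by ring) hA0 (by rw [h]; ring) h2r
        (natDegree_eq_of_two_mul_eq h2 hm hA0 (c := -1) (e := -1)
          (by rw [h2r]; simp; ring) (fun _ => by norm_num)) hP ?_ hPa' hDsf hδ hK
      rw [h, show (A ^ m - a - 1) ^ 2 - A - (a + 1) ^ 2 =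
        A ^ m * (A ^ m - 2 * (a + 1)) - A by ring]
      exact dvd_sub (hAm.mul_right _) hPA
  rw [← hASP]
  have hPq : (0 : ℚ) < P.natDegree := by exact_mod_cast hPdeg
  have h1 : (A.natDegree : ℚ) / P.natDegree ≤ idealClassNumber Fq K := by
    rw [div_le_iff₀ hPq]; exact_mod_cast hmain
  have h1' : (1 : ℚ) < (A.natDegree : ℚ) / P.natDegree := by
    rw [one_lt_div hPq]; exact_mod_cast (by omega)
  exact ⟨h1, h1', by exact_mod_cast h1'.trans_le h1⟩
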